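/- A continuum is a compact connected (non-empty) metric space; it is non-degenerate if it has more than one point. A tree is a space homeomorphic to the geometric realization of a finite connected acyclic graph (a single point is allowed). A branch point of a tree $T$ is a point of order at least $3$, i.e. a point $q$ having a neighbourhood $U$ such that every open set $V$ with $q\in V\subseteq U$ has at least three boundary points. A continuum $X$ is tree-like if for every $\varepsilon>0$ there is a continuous map of $X$ onto a tree all of whose fibres have diameter less than $\varepsilon$. A metric space $Y$ is chainable if for every $\varepsilon>0$ it is covered by finitely many open sets $U_1,\dots,U_k$ of $Y$, each of diameter less than $\varepsilon$, such that $U_i\cap U_j\neq\emptyset$ if and only if $|i-j|\le 1$. Let $X$ be a non-degenerate tree-like continuum, represented (up to homeomorphism) as the inverse limit $X=\varprojlim\{T_n,f_{nm}\}$ of an inverse sequence of trees $T_n$, $n\in\mathbb N$, with continuous surjective bonding maps $f_{nm}:T_m\to T_n$ ($n\le m$). Let $f_n:X\to T_n$ be the standard projections and put $$P_n=\bigcup\{f_n^{-1}(q) : q \text{ is a branch point of } T_n\}.$$ If $\bigcup_{n} P_n$ is not dense in $X$, then $X$ contains a non-degenerate chainable continuum. More generally, if for some strictly increasing sequence of indices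 $n_1<n_2<\cdots$ the union $\bigcup_i P_{n_i}$ is not dense in $X$, then $X$ contains a non-degenerate chainable continuum. -/

import Mathlib

open Set Topology

/-- The geometric realization of a graph on a finite vertex set: the union of its vertices and
edges, seen inside the standard simplex on the vertex set (barycentric coordinates). -/
def SimpleGraph.geomRealization {V : Type*} [Fintype V] (G : SimpleGraph V) : Set (V → ℝ) :=
  {x | x ∈ stdSimplex ℝ V ∧
    ∃ u v : V, (u = v ∨ G.Adj u v) ∧ ∀ w : V, w ≠ u → w ≠ v → x w = 0}

/-- A topological space is a (topological) tree if it is homeomorphic to the geometric realization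
of a finite connected acyclic graph. A one-point space is a degenerate tree. -/
def IsTopologicalTree (T : Type*) [TopologicalSpace T] : Prop :=
  ∃ (k : ℕ) (G : SimpleGraph (Fin k)), G.IsTree ∧ Nonempty (T ≃ₜ G.geomRealization)

/-- The (Menger–Urysohn) order of `p` in `T` is at most `k`: the point `p` has arbitrarily small
open neighbourhoods whose boundary has at most `k` points. -/
def OrderAtMost {T : Type*} [TopologicalSpace T] (p : T) (k : ℕ) : Prop :=
  ∀ U ∈ 𝓝 p, ∃ V : Set T, V ⊆ U ∧ IsOpen V ∧ p ∈ V ∧ (frontier V).encard ≤ k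

/-- A branch point is a point of order at least three. -/
def IsBranchPoint {T : Type*} [TopologicalSpace T] (p : T) : Prop :=
  ¬ OrderAtMost p 2

/-- A metric space is tree-like if for every `ε > 0` it admits an `ε`-map (a continuous map all of
whose fibres have diameter less than `ε`) onto some tree. -/
def IsTreeLike (X : Type*) [MetricSpace X] : Prop :=
  ∀ ε : ℝ, 0 < ε → ∃ (k : ℕ) (G : SimpleGraph (Fin k)) (g : X → G.geomRealization),
    G.IsTree ∧ Continuous g ∧ Function.Surjective g ∧
      ∀ y, Metric.ediam (g ⁻¹' {y}) < ENNReal.ofReal ε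

/-- A metric space is chainable if for every `ε > 0` it is covered by a finite chain of open sets
of diameter less than `ε`: links meet exactly when their indices differ by at most one. -/
def IsChainable (Y : Type*) [MetricSpace Y] : Prop :=
  ∀ ε : ℝ, 0 < ε → ∃ (k : ℕ) (U : Fin k → Set Y),
    (∀ i, IsOpen (U i)) ∧ (∀ i, Metric.ediam (U i) < ENNReal.ofReal ε) ∧ (⋃ i, U i) = univ ∧
      ∀ i j : Fin k, (U i ∩ U j).Nonempty ↔ (i : ℕ) ≤ (j : ℕ) + 1 ∧ (j : ℕ) ≤ (i : ℕ) + 1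

/-- `X` contains a non-degenerate chainable continuum. -/
def HasNondegenerateChainableSubcontinuum (X : Type*) [MetricSpace X] : Prop :=
  ∃ K : Set X, IsCompact K ∧ IsConnected K ∧ K.Nontrivial ∧ IsChainable K

/-- The inverse limit of an inverse sequence, as a subspace of the product. -/
def inverseLimit {T : ℕ → Type*} (f : ∀ ⦃n m : ℕ⦄, n ≤ m → T m → T n) : Set (∀ n, T n) :=
  {x | ∀ ⦃n m : ℕ⦄ (h : n ≤ m), f h (x m) = x n}

/-- The union of the fibres of a map over the branch points of its codomain. -/
def branchFibres {X T : Type*} [TopologicalSpace T] (p : X → T) : Set X :=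
  ⋃ q ∈ {q : T | IsBranchPoint q}, p ⁻¹' {q}

/-! A non-empty open set `U` missing all the branch fibres contains a non-degenerate continuum `K`
(boundary bumping, `exists_nontrivial_continuum_subset`). Each projection of `K` to a chosen `T (φ
n)` is connected and free of branch points, so it lies along one path of the tree and embeds in the
line (`IsTopologicalTree.exists_continuous_injOn`). Composing gives maps `K → ℝ` with the same
fibres as the projections, and these fibres become arbitrarily small (`exists_forall_ge_dist_lt`).
Pulling back a chain of intervals makes `K` chainable (`isChainable_of_small_fibers`). -/

/-! ### Continua and chains -/

/-- A compact connected metric space mapping to the line with arbitrarily small fibres is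
chainable. -/
theorem isChainable_of_small_fibers {Y : Type*} [MetricSpace Y] [CompactSpace Y]
    [ConnectedSpace Y]
    (h : ∀ ε : ℝ, 0 < ε → ∃ g : Y → ℝ, Continuous g ∧ ∀ x y, g x = g y → dist x y < ε) :
    IsChainable Y := by
  intro ε hε
  obtain ⟨g, hg, hgε⟩ := h (ε / 2) (half_pos hε)
  obtain ⟨δ, hδ, hgδ⟩ : ∃ δ : ℝ, 0 < δ ∧ ∀ x y, |g x - g y| < 2 * δ → dist x y < ε / 2 := by
    -- On the compact set of pairs at distance at least `ε / 2`, `|g x - g y|` has a positive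
    -- minimum; `δ` is half of it, because links will have width `2 * δ` in the values of `g`.
    set S : Set (Y × Y) := {z | ε / 2 ≤ dist z.1 z.2}
    have hS : IsCompact S := (isClosed_le continuous_const continuous_dist).isCompact
    rcases S.eq_empty_or_nonempty with hE | hne
    · refine ⟨1, one_pos, fun x y _ => ?_⟩
      by_contra hxy
      exact (hE ▸ (show (x, y) ∈ S from not_lt.1 hxy) : (x, y) ∈ (∅ : Set (Y × Y)))
    · obtain ⟨z, hz, hmin⟩ := hS.exists_isMinOn hne
        (f := fun z : Y × Y => |g z.1 - g z.2|) (by fun_prop)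
      have hpos : 0 < |g z.1 - g z.2| := by
        rw [abs_pos, sub_ne_zero]
        exact fun h => (hgε _ _ h).not_ge hz
      refine ⟨|g z.1 - g z.2| / 2, half_pos hpos, fun x y hxy => ?_⟩
      by_contra hc
      have := hmin (show (x, y) ∈ S from not_lt.1 hc)
      simp only [mem_ofPred_eq] at this
      linarith
  obtain ⟨a, -, ha⟩ := isCompact_univ.exists_isMinOn univ_nonempty hg.continuousOn
  obtain ⟨b, -, hb⟩ := isCompact_univ.exists_isMaxOn univ_nonempty hg.continuousOn
  set u : Y → ℝ := fun x => (g x - g a) / δ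
  have hu : Continuous u := by fun_prop
  have hu0 : ∀ x, 0 ≤ u x := fun x => div_nonneg (sub_nonneg.2 (ha (mem_univ x))) hδ.le
  have hub : ∀ x, u x ≤ u b := fun x => by
    have := hb (mem_univ x)
    simp only [mem_ofPred_eq] at this
    simp only [u]
    gcongr
  have hsurj : ∀ t, 0 ≤ t → t ≤ u b → ∃ x, u x = t := fun t h0 h1 =>
    mem_range_of_exists_le_of_exists_ge hu ⟨a, by simpa [u] using h0⟩ ⟨b, h1⟩
  have hudist : ∀ x y, |u x - u y| < 2 → dist x y < ε / 2 := by
    intro x y hxy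
    apply hgδ
    have : u x - u y = (g x - g y) / δ := by simp only [u]; ring
    rwa [this, abs_div, abs_of_pos hδ, div_lt_iff₀ hδ] at hxy
  have hidx : ∀ i : Fin (⌊u b⌋₊ + 1), ((i : ℕ) : ℝ) ≤ u b := fun i =>
    (Nat.le_floor_iff (hu0 b)).1 (Nat.lt_succ_iff.1 i.2)
  -- The range of `u` is `[0, u b]`; the links are the preimages of `(i - 1, i + 1)` for `i = 0, …,
  -- ⌊u b⌋`.
  refine ⟨⌊u b⌋₊ + 1, fun i => {x | |u x - (i : ℕ)| < 1}, fun i => ?_, fun i => ?_, ?_, ?_⟩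
  · exact isOpen_lt (by fun_prop) continuous_const
  · refine lt_of_le_of_lt (Metric.ediam_le (d := ENNReal.ofReal (ε / 2)) fun x hx y hy => ?_)
      ((ENNReal.ofReal_lt_ofReal_iff hε).2 (half_lt_self hε))
    rw [edist_dist]
    refine ENNReal.ofReal_le_ofReal (hudist x y ?_).le
    simp only [mem_ofPred_eq, abs_lt] at hx hy ⊢
    constructor <;> linarith [hx.1, hx.2, hy.1, hy.2]
  · refine eq_univ_of_forall fun x => mem_iUnion.2
      ⟨⟨⌊u x⌋₊, Nat.lt_succ_iff.2 (Nat.floor_le_floor (hub x))⟩, ?_⟩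
    have h1 := Nat.floor_le (hu0 x)
    have h2 := Nat.lt_floor_add_one (u x)
    simp only [mem_ofPred_eq, abs_lt]
    constructor <;> linarith
  · intro i j
    constructor
    · rintro ⟨x, hi, hj⟩
      simp only [mem_ofPred_eq, abs_lt] at hi hj
      have h1 : ((i : ℕ) : ℝ) < (j : ℕ) + 2 := by linarith [hi.1, hi.2, hj.1, hj.2]
      have h2 : ((j : ℕ) : ℝ) < (i : ℕ) + 2 := by linarith [hi.1, hi.2, hj.1, hj.2]
      norm_cast at h1 h2
      omega
    · rintro ⟨h1, h2⟩
      have h1' : ((i : ℕ) : ℝ) ≤ (j : ℕ) + 1 := by exact_mod_cast h1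
      have h2' : ((j : ℕ) : ℝ) ≤ (i : ℕ) + 1 := by exact_mod_cast h2
      -- The midpoint is within `1 / 2` of both centres, and it is a value of `u` by the
      -- intermediate value theorem.
      obtain ⟨x, hx⟩ := hsurj (((i : ℕ) + (j : ℕ)) / 2) (by positivity)
        (by linarith [hidx i, hidx j])
      refine ⟨x, ?_, ?_⟩ <;> simp only [mem_ofPred_eq, abs_lt, hx] <;> constructor <;> linarith

/-- Boundary bumping: a nonempty open subset of a non-degenerate continuum contains a
non-degenerate continuum. -/
theorem exists_nontrivial_continuum_subset {X : Type*} [MetricSpace X] [CompactSpace X]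
    [ConnectedSpace X] [Nontrivial X] {U : Set X} (hU : IsOpen U) (hne : U.Nonempty) :
    ∃ K ⊆ U, IsCompact K ∧ IsConnected K ∧ K.Nontrivial := by
  obtain ⟨x, hx⟩ := hne
  obtain ⟨y, hyx⟩ := exists_ne x
  obtain ⟨r, hr, hrU⟩ := Metric.isOpen_iff.1 hU x hx
  set ρ := min (r / 2) (dist y x / 2)
  have hρ : 0 < ρ := lt_min (half_pos hr) (half_pos (dist_pos.2 hyx))
  set C := Metric.closedBall x ρ
  have hCU : C ⊆ U := (Metric.closedBall_subset_ball
    ((min_le_left _ _).trans_lt (half_lt_self hr))).trans hrU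
  have hyC : y ∉ C := fun h =>
    ((Metric.mem_closedBall.1 h).trans (min_le_right _ _)).not_gt (half_lt_self (dist_pos.2 hyx))
  have hCc : IsClosed C := Metric.isClosed_closedBall
  have : CompactSpace C := isCompact_iff_compactSpace.1 hCc.isCompact
  set x' : C := ⟨x, Metric.mem_closedBall_self hρ.le⟩
  refine ⟨Subtype.val '' connectedComponent x', ?_, ?_, ?_, ?_⟩
  · exact (Subtype.coe_image_subset C _).trans hCU
  · exact isClosed_connectedComponent.isCompact.image continuous_subtype_val
  · exact isConnected_connectedComponent.image _ continuous_subtype_val.continuousOn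
  · refine Set.Nontrivial.image ?_ Subtype.val_injective
    by_contra hnt
    -- A trivial component lies in the open ball. In a compact space it is the intersection of the
    -- clopen sets around it, so one of these already lies in the open ball.
    have hsing : connectedComponent x' ⊆ Subtype.val ⁻¹' Metric.ball x ρ := by
      intro z hz
      rw [(not_nontrivial_iff.1 hnt) hz mem_connectedComponent]
      exact Metric.mem_ball_self hρ
    rw [connectedComponent_eq_iInter_isClopen] at hsing
    have : Nonempty {s : Set C // IsClopen s ∧ x' ∈ s} := ⟨⟨univ, isClopen_univ, mem_univ _⟩⟩
    obtain ⟨V, hV⟩ := exists_subset_nhds_of_compactSpace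
      (V := fun s : {s : Set C // IsClopen s ∧ x' ∈ s} => s.1)
      (by
        rintro ⟨s, hs⟩ ⟨t, ht⟩
        exact ⟨⟨s ∩ t, hs.1.inter ht.1, hs.2, ht.2⟩, inter_subset_left, inter_subset_right⟩)
      (fun s => s.2.1.1)
      (U := Subtype.val ⁻¹' Metric.ball x ρ)
      (fun z hz => (Metric.isOpen_ball.preimage continuous_subtype_val).mem_nhds (hsing hz))
    -- Staying off the boundary of the ball, this set is open in `X` as well as closed;
    -- connectedness makes it all of `X`, though it misses `y`.
    have hclopen : IsClopen (Subtype.val '' V.1 : Set X) := by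
      refine ⟨hCc.isClosedEmbedding_subtypeVal.isClosedMap _ V.2.1.1, ?_⟩
      obtain ⟨W, hW, hWV⟩ := isOpen_induced_iff.1 V.2.1.2
      have : (Subtype.val '' V.1 : Set X) = W ∩ Metric.ball x ρ := by
        ext z
        constructor
        · rintro ⟨w, hw, rfl⟩
          exact ⟨by rw [← hWV] at hw; exact hw, hV hw⟩
        · rintro ⟨hzW, hzB⟩
          refine ⟨⟨z, Metric.ball_subset_closedBall hzB⟩, ?_, rfl⟩
          rw [← hWV]
          exact hzW
      rw [this]
      exact hW.inter Metric.isOpen_ball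
    have huniv := hclopen.eq_univ ⟨x, x', V.2.2, rfl⟩
    obtain ⟨z, -, hz⟩ := huniv.symm ▸ mem_univ y
    exact hyC (hz ▸ z.2)

/-- The projections of a compact inverse limit have eventually small fibres. -/
theorem exists_forall_ge_dist_lt {X : Type*} [MetricSpace X] [CompactSpace X]
    {T : ℕ → Type*} [∀ n, TopologicalSpace (T n)] [∀ n, T2Space (T n)]
    (f : ∀ ⦃n m : ℕ⦄, n ≤ m → T m → T n) (e : X ≃ₜ inverseLimit f) {ε : ℝ} (hε : 0 < ε) :
    ∃ n, ∀ m, n ≤ m → ∀ x y : X,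
      (e x : ∀ n, T n) m = (e y : ∀ n, T n) m → dist x y < ε := by
  -- These compact sets decrease; a common point would be a pair with all coordinates equal and yet
  -- at distance at least `ε`.
  set E : ℕ → Set (X × X) := fun n =>
    {z | ε ≤ dist z.1 z.2} ∩ {z | (e z.1 : ∀ n, T n) n = (e z.2 : ∀ n, T n) n}
  have hcoord : ∀ n, Continuous fun x : X => (e x : ∀ n, T n) n := fun n =>
    (continuous_apply n).comp (continuous_subtype_val.comp e.continuous)
  have hclosed : ∀ n, IsClosed (E n) := fun n =>
    (isClosed_le continuous_const continuous_dist).inter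
      (isClosed_eq ((hcoord n).comp continuous_fst) ((hcoord n).comp continuous_snd))
  have hmono : ∀ n m, n ≤ m → E m ⊆ E n := by
    rintro n m hnm z ⟨hz, hzm⟩
    refine ⟨hz, ?_⟩
    have h1 := (e z.1).2 hnm
    have h2 := (e z.2).2 hnm
    simp only [mem_ofPred_eq] at hzm ⊢
    rw [← h1, ← h2, hzm]
  obtain ⟨n, hn⟩ : ∃ n, E n = ∅ := by
    by_contra! hne
    obtain ⟨z, hz⟩ := IsCompact.nonempty_iInter_of_sequence_nonempty_isCompact_isClosed E
      (fun n => hmono n (n + 1) n.le_succ) hne (hclosed 0).isCompact hclosed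
    rw [mem_iInter] at hz
    have : z.1 = z.2 := e.injective (Subtype.ext (funext fun n => (hz n).2))
    have h0 : ε ≤ dist z.1 z.2 := (hz 0).1
    rw [this, dist_self] at h0
    exact h0.not_gt hε
  refine ⟨n, fun m hm x y hxy => ?_⟩
  by_contra hc
  have : (x, y) ∈ E n := hmono n m hm ⟨not_lt.1 hc, hxy⟩
  rw [hn] at this
  exact this

/-! ### Branch points of trees -/

theorem OrderAtMost.of_homeomorph {S T : Type*} [TopologicalSpace S] [TopologicalSpace T]
    (h : S ≃ₜ T) {p : S} {k : ℕ} (hp : OrderAtMost (h p) k) : OrderAtMost p k := by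
  intro U hU
  obtain ⟨V, hVU, hV, hpV, hk⟩ := hp (h.symm ⁻¹' U)
    (h.symm.continuous.continuousAt.preimage_mem_nhds (by simpa using hU))
  refine ⟨h ⁻¹' V, fun x hx => by simpa using hVU hx, hV.preimage h.continuous, hpV, ?_⟩
  rw [← h.preimage_frontier, ← h.symm_symm, ← Homeomorph.image_eq_preimage_symm,
    h.symm.injective.encard_image]
  exact hk

theorem IsBranchPoint.homeomorph {S T : Type*} [TopologicalSpace S] [TopologicalSpace T]
    (h : S ≃ₜ T) {p : S} (hp : IsBranchPoint p) : IsBranchPoint (h p) :=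
  fun H => hp (H.of_homeomorph h)

/-- A point of the standard simplex vanishing off two vertices is a combination of them. -/
theorem eq_smul_single_add_of_mem_stdSimplex {V : Type*} [Fintype V] [DecidableEq V]
    {x : V → ℝ} (hx : x ∈ stdSimplex ℝ V) {u v : V} (huv : u ≠ v)
    (h : ∀ w, w ≠ u → w ≠ v → x w = 0) :
    x u + x v = 1 ∧ x = x u • Pi.single u 1 + x v • Pi.single v 1 := by
  constructor
  · rw [← hx.2, ← Finset.sum_pair huv]
    refine Finset.sum_subset (Finset.subset_univ _) fun w _ hw => ?_
    simp only [Finset.mem_insert, Finset.mem_singleton, not_or] at hw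
    exact h w hw.1 hw.2
  · funext w
    by_cases hu : w = u
    · subst hu; simp [huv]
    · by_cases hv : w = v
      · subst hv; simp [hu]
      · simp [hu, hv, h w hu hv]

theorem eq_single_of_mem_stdSimplex {V : Type*} [Fintype V] [DecidableEq V]
    {x : V → ℝ} (hx : x ∈ stdSimplex ℝ V) {u : V} (h : ∀ w, w ≠ u → x w = 0) :
    x = Pi.single u 1 := by
  have h1 : x u = 1 := by
    rw [← hx.2]
    exact (Finset.sum_eq_single u (fun w _ hw => h w hw) (by simp)).symm
  funext w
  by_cases hu : w = u
  · subst hu; simp [h1]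
  · simp [hu, h w hu]

namespace SimpleGraph

variable {V : Type*} [Fintype V] [DecidableEq V] {G : SimpleGraph V}

/-- Travelling along the edge from `v`, one must leave `U` because the `v`-coordinate vanishes at
`w`. The positive `w`-coordinate of the exit point tells exits along different edges apart. -/
theorem exists_mem_frontier_of_adj {v w : V} (hvw : G.Adj v w) {U : Set G.geomRealization}
    (hU : IsOpen U) (hUv : ∀ x ∈ U, 0 < x.1 v) {p : G.geomRealization} (hpU : p ∈ U)
    (hp : p.1 = Pi.single v 1) :
    ∃ y ∈ frontier U, 0 < y.1 w ∧ ∀ z, z ≠ v → z ≠ w → y.1 z = 0 := by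
  have hne : v ≠ w := hvw.ne
  let γ : unitInterval → G.geomRealization := fun t =>
    ⟨(1 - t.1) • Pi.single v 1 + t.1 • Pi.single w 1,
      (convex_stdSimplex ℝ V) (single_mem_stdSimplex ℝ v) (single_mem_stdSimplex ℝ w)
        (sub_nonneg.2 t.2.2) t.2.1 (by ring),
      v, w, Or.inr hvw, fun z hz hz' => by simp [hz, hz']⟩
  have hγ : Continuous γ := Continuous.subtype_mk (by fun_prop) _
  have h0 : γ 0 = p := Subtype.ext (by simp [γ, hp])
  have h1 : γ 1 ∉ U := fun h => by simpa [γ, hne] using hUv _ h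
  obtain ⟨t, ht⟩ := nonempty_frontier_iff.2
    (⟨⟨0, by simpa [h0] using hpU⟩, fun h => h1 (show (1 : unitInterval) ∈ γ ⁻¹' U by simp [h])⟩ :
      (γ ⁻¹' U).Nonempty ∧ γ ⁻¹' U ≠ univ)
  have htU : γ t ∈ frontier U := hγ.frontier_preimage_subset U ht
  refine ⟨γ t, htU, ?_, fun z hz hz' => by simp [γ, hz, hz']⟩
  have ht0 : t ≠ 0 := by
    rintro rfl
    rw [h0, hU.frontier_eq] at htU
    exact htU.2 hpU
  simpa [γ, hne.symm] using unitInterval.pos_iff_ne_zero.2 ht0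

/-- A vertex with three neighbours is a branch point of the geometric realization. -/
theorem isBranchPoint_of_three_adj {v a b c : V} (ha : G.Adj v a) (hb : G.Adj v b)
    (hc : G.Adj v c) (hab : a ≠ b) (hac : a ≠ c) (hbc : b ≠ c) {p : G.geomRealization}
    (hp : p.1 = Pi.single v 1) : IsBranchPoint p := by
  intro hord
  -- The open star of `v` contains no other vertex, so the frontier of `U` meets each of the three
  -- edges.
  obtain ⟨U, hUv, hU, hpU, hcard⟩ := hord {x | 0 < x.1 v}
    ((isOpen_lt continuous_const ((continuous_apply v).comp continuous_subtype_val)).mem_nhds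
      (by simp [hp]))
  obtain ⟨x, hxU, hxa, hx⟩ := exists_mem_frontier_of_adj ha hU hUv hpU hp
  obtain ⟨y, hyU, hyb, hy⟩ := exists_mem_frontier_of_adj hb hU hUv hpU hp
  obtain ⟨z, hzU, hzc, hz⟩ := exists_mem_frontier_of_adj hc hU hUv hpU hp
  have hxy : x ≠ y := by
    rintro rfl
    exact hxa.ne' (hy a ha.ne' hab)
  have hxz : x ≠ z := by
    rintro rfl
    exact hxa.ne' (hz a ha.ne' hac)
  have hyz : y ≠ z := by
    rintro rfl
    exact hyb.ne' (hz b hb.ne' hbc)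
  have h3 : ({x, y, z} : Set G.geomRealization).encard = 3 :=
    encard_eq_three.2 ⟨x, y, z, hxy, hxz, hyz, rfl⟩
  have hle := (encard_le_encard (show ({x, y, z} : Set G.geomRealization) ⊆ frontier U by
    rintro _ (rfl | rfl | rfl) <;> assumption)).trans hcard
  rw [h3] at hle
  exact absurd hle (by decide)

/-- Adjacent vertices of a path in an acyclic graph are consecutive on the path. -/
theorem IsAcyclic.eq_succ_of_adj_getVert {W : Type*} {G : SimpleGraph W}
    (hG : G.IsAcyclic) {u v : W} {p : G.Walk u v}
    (hp : p.IsPath) {i j : ℕ} (hij : i ≤ j) (hj : j ≤ p.length)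
    (hadj : G.Adj (p.getVert i) (p.getVert j)) : j = i + 1 := by
  have hend : (p.drop i).getVert (j - i) = p.getVert j := by
    rw [Walk.drop_getVert]; congr 1; omega
  have hadj' : G.Adj (p.getVert i) ((p.drop i).getVert (j - i)) := hend ▸ hadj
  -- Paths in an acyclic graph are unique, so the segment from `i` to `j` is the single edge and has
  -- length one.
  have huniq := (hG.subsingleton_path _ _).elim
    ⟨(p.drop i).take (j - i), (hp.drop i).take _⟩ (Path.singleton hadj')
  have hlen := congrArg (fun q => q.1.length) huniq
  simp [Path.singleton, Walk.take_length, Walk.drop_length] at hlen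
  omega

end SimpleGraph

/-! ### Connected subsets of trees without branch points -/

namespace SimpleGraph

variable {V : Type*} [Fintype V] [DecidableEq V] {G : SimpleGraph V}

/-- The edges of `G` whose interior meets `A`. -/
def edgesMeeting (G : SimpleGraph V) (A : Set (V → ℝ)) : SimpleGraph V where
  Adj u v := G.Adj u v ∧ ∃ x ∈ A, 0 < x u ∧ 0 < x v
  symm := ⟨fun _ _ ⟨h, x, hx, hu, hv⟩ => ⟨h.symm, x, hx, hv, hu⟩⟩
  loopless := ⟨fun _ h => G.loopless.irrefl _ h.1⟩

/-- A connected subset of the geometric realization containing no vertex with three neighbours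
lies over a path. -/
theorem exists_isPath_of_isPreconnected {A : Set (V → ℝ)} (hAG : A ⊆ G.geomRealization)
    (hA : IsPreconnected A) (hne : A.Nonempty)
    (hdeg : ∀ v, Pi.single v 1 ∈ A → ∀ a b c, G.Adj v a → G.Adj v b → G.Adj v c →
      a ≠ b → a ≠ c → b ≠ c → False) :
    ∃ (u v : V) (p : G.Walk u v), p.IsPath ∧ ∀ x ∈ A, ∀ w, w ∉ p.support → x w = 0 := by
  set H := G.edgesMeeting A
  -- Choose a longest path in `H` whose realization meets `A`. The part of `A` over it will be
  -- clopen in `A`, hence all of `A`.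
  let Q : ℕ → Prop := fun n => ∃ (u v : V) (p : H.Walk u v), p.IsPath ∧ p.length = n ∧
    ∃ x ∈ A, ∀ w, w ∉ p.support → x w = 0
  have hnn : ∀ x ∈ A, ∀ w, 0 ≤ x w := fun x hx => (hAG hx).1.1
  have hpos : ∀ x ∈ A, ∀ w, x w ≠ 0 → 0 < x w := fun x hx w h => (hnn x hx w).lt_of_ne' h
  have hQ : ∃ n, Q n := by
    obtain ⟨x, hx⟩ := hne
    obtain ⟨u, v, huv, hsupp⟩ := (hAG hx).2
    by_cases hadj : H.Adj u v
    · exact ⟨1, u, v, Walk.cons hadj Walk.nil, by simp [hadj.ne], rfl, x, hx,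
        fun w hw => by simp at hw; exact hsupp w hw.1 hw.2⟩
    · by_cases hv : x v = 0
      · refine ⟨0, u, u, Walk.nil, by simp, rfl, x, hx, fun w hw => ?_⟩
        by_cases hwv : w = v
        · exact hwv ▸ hv
        · exact hsupp w (by simpa using hw) hwv
      · refine ⟨0, v, v, Walk.nil, by simp, rfl, x, hx, fun w hw => ?_⟩
        rcases huv with rfl | huv
        · exact hsupp w (by simpa using hw) (by simpa using hw)
        · by_cases hwu : w = u
          · subst hwu
            by_contra hu
            exact hadj ⟨huv, x, hx, hpos x hx _ hu, hpos x hx _ hv⟩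
          · exact hsupp w hwu (by simpa using hw)
  have hbdd : BddAbove {n | Q n} := ⟨Fintype.card V, by
    rintro n ⟨u, v, p, hp, rfl, -⟩
    exact hp.length_lt.le⟩
  obtain ⟨u, v, p, hp, hlen, x₀, hx₀, hx₀p⟩ : Q (sSup {n | Q n}) := Nat.sSup_mem hQ hbdd
  have hmax : ∀ n, Q n → n ≤ p.length := fun n hn => hlen ▸ le_csSup hbdd hn
  have hle : H ≤ G := fun a b h => h.1
  refine ⟨u, v, p.mapLe hle, hp.mapLe hle, ?_⟩
  rw [Walk.support_mapLe_eq_support]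
  set C : Set A := {x | ∀ w, w ∉ p.support → x.1 w = 0}
  have hcoord : ∀ w, Continuous fun x : A => x.1 w := fun w =>
    (continuous_apply w).comp continuous_subtype_val
  have hCclosed : IsClosed C := by
    simp only [C, ofPred_forall]
    exact isClosed_iInter fun w => isClosed_iInter fun _ =>
      isClosed_eq (hcoord w) continuous_const
  have hCopen : IsOpen C := by
    rw [isOpen_iff_mem_nhds]
    rintro ⟨a, ha⟩ haC
    have hnear : ∀ᶠ y : A in 𝓝 ⟨a, ha⟩, ∀ w, a w ≠ 0 → y.1 w ≠ 0 := by
      rw [Filter.eventually_all]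
      intro w
      by_cases hw : a w = 0
      · simp [hw]
      · filter_upwards [((hcoord w).continuousAt (x := ⟨a, ha⟩)).eventually_ne hw] with y hy _ using hy
    filter_upwards [hnear]
    rintro ⟨y, hy⟩ hay w hw
    -- Near `a` no non-zero coordinate vanishes, so a point `y` off the path must lie inside an edge
    -- `z w` with `a` equal to the vertex `z`. If `z` is an end of `p`, the edge prolongs `p`;
    -- otherwise `z` has three neighbours.
    by_contra hyw
    have haw : a w = 0 := haC w hw
    obtain ⟨z, hz⟩ : ∃ z, a z ≠ 0 := by
      by_contra! h
      have := (hAG ha).1.2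
      simp [h] at this
    have hyz := hay z hz
    have hzw : z ≠ w := by rintro rfl; exact hz haw
    have hzp : z ∈ p.support := by
      by_contra h
      exact hz (haC z h)
    obtain ⟨u', v', huv', hsupp⟩ := (hAG hy).2
    have hmem : ∀ t, y t ≠ 0 → t = u' ∨ t = v' := fun t ht => by
      by_contra! h
      exact ht (hsupp t h.1 h.2)
    have hadj : G.Adj z w := by
      rcases hmem z hyz with rfl | rfl <;> rcases hmem w hyw with rfl | rfl
      · exact absurd rfl hzw
      · exact huv'.resolve_left hzw
      · exact (huv'.resolve_left hzw.symm).symm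
      · exact absurd rfl hzw
    have hHadj : H.Adj z w := ⟨hadj, y, hy, hpos y hy z hyz, hpos y hy w hyw⟩
    have hasingle : a = Pi.single z 1 := by
      refine eq_single_of_mem_stdSimplex (hAG ha).1 fun t ht => ?_
      by_contra hat
      have htw : t ≠ w := by rintro rfl; exact hat haw
      rcases hmem t (hay t hat) with rfl | rfl <;> rcases hmem z hyz with rfl | rfl <;>
        rcases hmem w hyw with rfl | rfl <;> simp_all
    obtain ⟨i, rfl, hi⟩ := Walk.mem_support_iff_exists_getVert.1 hzp
    rcases Nat.eq_zero_or_pos i with rfl | hi0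
    · rw [Walk.getVert_zero] at hHadj
      have := hmax (p.length + 1) ⟨w, v, Walk.cons hHadj.symm p, hp.cons hw, rfl, x₀, hx₀,
        fun t ht => hx₀p t fun h => ht (by simp [h])⟩
      omega
    rcases hi.eq_or_lt with rfl | hil
    · rw [Walk.getVert_length] at hHadj
      have := hmax (p.length + 1) ⟨u, w, p.concat hHadj, hp.concat hw _, by simp, x₀, hx₀,
        fun t ht => hx₀p t fun h => ht (by simp [Walk.support_concat, h])⟩
      omega
    · obtain ⟨j, rfl⟩ : ∃ j, i = j + 1 := ⟨i - 1, by omega⟩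
      refine hdeg _ (hasingle ▸ ha) (p.getVert j) (p.getVert (j + 1 + 1)) w
        (hle (p.adj_getVert_succ (by omega))).symm (hle (p.adj_getVert_succ hil)) hadj ?_ ?_ ?_
      · intro h
        have := hp.getVert_injOn (show j ≤ p.length by omega) (show j + 1 + 1 ≤ p.length by omega) h
        omega
      · rintro rfl
        exact hw (p.getVert_mem_support _)
      · rintro rfl
        exact hw (p.getVert_mem_support _)
  have : PreconnectedSpace A := isPreconnected_iff_preconnectedSpace.1 hA
  have huniv := IsClopen.eq_univ ⟨hCclosed, hCopen⟩ ⟨⟨x₀, hx₀⟩, hx₀p⟩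
  intro x hx
  exact (huniv ▸ mem_univ (⟨x, hx⟩ : A) : (⟨x, hx⟩ : A) ∈ C)

/-- The part of the realization of an acyclic graph over a path embeds in the line. -/
theorem IsAcyclic.exists_continuous_injOn_of_isPath (hG : G.IsAcyclic) {u v : V} {p : G.Walk u v}
    (hp : p.IsPath) {A : Set (V → ℝ)} (hAG : A ⊆ G.geomRealization)
    (hAp : ∀ x ∈ A, ∀ w, w ∉ p.support → x w = 0) :
    ∃ F : (V → ℝ) → ℝ, Continuous F ∧ InjOn F A := by
  set φ : V → ℕ := Function.invFunOn p.getVert {i | i ≤ p.length}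
  have hφ : ∀ i ≤ p.length, φ (p.getVert i) = i := fun i hi =>
    hp.getVert_injOn.leftInvOn_invFunOn hi
  -- The affine extension of the position along the path.
  set F : (V → ℝ) → ℝ := fun x => ∑ w, x w * φ w
  have hFlin : ∀ (s t : ℝ) (a b : V),
      F (s • Pi.single a 1 + t • Pi.single b 1) = s * φ a + t * φ b := by
    intro s t a b
    simp [F, add_mul, Finset.sum_add_distrib, Pi.single_apply]
  -- The integer and fractional parts of `F x` determine `x`, whence injectivity. At the last vertex
  -- `t = 0`, so the default value of `getVert` past the end has coefficient zero.
  have hnormal : ∀ x ∈ A, ∃ (i : ℕ) (t : ℝ), 0 ≤ t ∧ t < 1 ∧ F x = i + t ∧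
      x = (1 - t) • Pi.single (p.getVert i) 1 + t • Pi.single (p.getVert (i + 1)) 1 := by
    intro x hx
    have hxS := (hAG hx).1
    have hvertex : ∀ w, x = Pi.single w 1 → ∃ (i : ℕ) (t : ℝ), 0 ≤ t ∧ t < 1 ∧ F x = i + t ∧
      x = (1 - t) • Pi.single (p.getVert i) 1 + t • Pi.single (p.getVert (i + 1)) 1 := by
      intro w hw
      have hwp : w ∈ p.support := by
        by_contra h
        have := hAp x hx w h
        simp [hw] at this
      obtain ⟨i, rfl, hi⟩ := Walk.mem_support_iff_exists_getVert.1 hwp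
      refine ⟨i, 0, le_rfl, one_pos, ?_, by simp [hw]⟩
      have := hFlin 1 0 (p.getVert i) (p.getVert i)
      simpa [hφ i hi, ← hw] using this
    have hedge : ∀ i j, i ≤ j → j ≤ p.length → G.Adj (p.getVert i) (p.getVert j) →
        (∀ w, w ≠ p.getVert i → w ≠ p.getVert j → x w = 0) → x (p.getVert i) ≠ 0 →
        ∃ (i : ℕ) (t : ℝ), 0 ≤ t ∧ t < 1 ∧ F x = i + t ∧
      x = (1 - t) • Pi.single (p.getVert i) 1 + t • Pi.single (p.getVert (i + 1)) 1 := by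
      intro i j hij hj hadj hsupp hxi
      -- Acyclicity excludes chords, on which `F` could repeat values taken along the path.
      obtain rfl := hG.eq_succ_of_adj_getVert hp hij hj hadj
      obtain ⟨hsum, hxe⟩ := eq_smul_single_add_of_mem_stdSimplex hxS hadj.ne hsupp
      have hi0 := (hxS.1 (p.getVert i)).lt_of_ne' hxi
      refine ⟨i, x (p.getVert (i + 1)), hxS.1 _, by linarith, ?_, ?_⟩
      · have := hFlin (x (p.getVert i)) (x (p.getVert (i + 1))) (p.getVert i) (p.getVert (i + 1))
        rw [← hxe, hφ i (by omega), hφ _ hj] at this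
        rw [this]
        have h1 : x (p.getVert i) = 1 - x (p.getVert (i + 1)) := by linarith
        rw [h1]; push_cast; ring
      · rwa [← eq_sub_iff_add_eq.2 hsum]
    obtain ⟨a, b, hab, hsupp⟩ := (hAG hx).2
    by_cases hb : x b = 0
    · refine hvertex a (eq_single_of_mem_stdSimplex hxS fun w hw => ?_)
      by_cases hwb : w = b
      · exact hwb ▸ hb
      · exact hsupp w hw hwb
    by_cases ha : x a = 0
    · refine hvertex b (eq_single_of_mem_stdSimplex hxS fun w hw => ?_)
      by_cases hwa : w = a
      · exact hwa ▸ ha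
      · exact hsupp w hwa hw
    rcases hab with rfl | hab
    · exact hvertex a (eq_single_of_mem_stdSimplex hxS fun w hw => hsupp w hw hw)
    have hmem : ∀ w, x w ≠ 0 → w ∈ p.support := fun w hw => by
      by_contra h
      exact hw (hAp x hx w h)
    obtain ⟨i, rfl, hi⟩ := Walk.mem_support_iff_exists_getVert.1 (hmem a ha)
    obtain ⟨j, rfl, hj⟩ := Walk.mem_support_iff_exists_getVert.1 (hmem b hb)
    rcases le_total i j with hij | hij
    · exact hedge i j hij hj hab hsupp ha
    · exact hedge j i hij hi hab.symm (fun w h1 h2 => hsupp w h2 h1) hb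
  refine ⟨F, by fun_prop, fun x hx y hy hxy => ?_⟩
  obtain ⟨i, s, hs0, hs1, hFx, hxe⟩ := hnormal x hx
  obtain ⟨j, t, ht0, ht1, hFy, hye⟩ := hnormal y hy
  rw [hFx, hFy] at hxy
  have h1 : (i : ℝ) < j + 1 := by linarith
  have h2 : (j : ℝ) < i + 1 := by linarith
  norm_cast at h1 h2
  obtain rfl : i = j := by omega
  obtain rfl : s = t := by linarith
  rw [hxe, hye]

end SimpleGraph

/-- A connected subset of a tree that contains no branch point embeds in the line. -/
theorem IsTopologicalTree.exists_continuous_injOn {T : Type*} [TopologicalSpace T]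
    (hT : IsTopologicalTree T) {A : Set T} (hA : IsPreconnected A)
    (hbr : ∀ q ∈ A, ¬ IsBranchPoint q) : ∃ F : T → ℝ, Continuous F ∧ InjOn F A := by
  obtain ⟨k, G, hG, ⟨h⟩⟩ := hT
  rcases A.eq_empty_or_nonempty with rfl | hne
  · exact ⟨fun _ => 0, continuous_const, injOn_empty _⟩
  set c : T → Fin k → ℝ := fun x => (h x).1
  have hc : Continuous c := continuous_subtype_val.comp h.continuous
  have hAG : c '' A ⊆ G.geomRealization := by
    rintro _ ⟨x, -, rfl⟩
    exact (h x).2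
  obtain ⟨u, v, p, hp, hAp⟩ := SimpleGraph.exists_isPath_of_isPreconnected hAG
    (hA.image c hc.continuousOn) (hne.image c) (by
      rintro v ⟨x, hx, hxv⟩ a b d ha hb hd hab had hbd
      refine hbr x hx ?_
      have := SimpleGraph.isBranchPoint_of_three_adj ha hb hd hab had hbd (p := h x) hxv
      simpa using this.homeomorph h.symm)
  obtain ⟨F, hF, hinj⟩ := hG.isAcyclic.exists_continuous_injOn_of_isPath hp hAG hAp
  exact ⟨F ∘ c, hF.comp hc, hinj.comp (Subtype.val_injective.comp h.injective).injOn
    (mapsTo_image c A)⟩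

/-! ### From a non-dense union of branch fibres to a chainable continuum. -/

/-- Covers both claims, the full sequence being `φ = id`. A subsequence suffices since `n ≤ φ n`, so
the fibres over `T (φ n)` are small as soon as `n` is large. -/
theorem hasNondegenerateChainableSubcontinuum_of_not_dense {X : Type*} [MetricSpace X]
    [CompactSpace X] [ConnectedSpace X] [Nontrivial X]
    {T : ℕ → Type*} [∀ n, TopologicalSpace (T n)] (hT : ∀ n, IsTopologicalTree (T n))
    (f : ∀ ⦃n m : ℕ⦄, n ≤ m → T m → T n) (e : X ≃ₜ inverseLimit f)
    {φ : ℕ → ℕ} (hφ : StrictMono φ)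
    (hd : ¬ Dense (⋃ i, branchFibres (fun x : X => (e x : ∀ n, T n) (φ i)))) :
    HasNondegenerateChainableSubcontinuum X := by
  have hT2 : ∀ n, T2Space (T n) := fun n => by
    obtain ⟨k, G, -, ⟨h⟩⟩ := hT n
    exact h.isEmbedding.t2Space
  rw [dense_iff_inter_open] at hd
  push Not at hd
  obtain ⟨U, hU, hUne, hUd⟩ := hd
  obtain ⟨K, hKU, hKc, hKconn, hKnt⟩ := exists_nontrivial_continuum_subset hU hUne
  refine ⟨K, hKc, hKconn, hKnt, ?_⟩
  have : CompactSpace K := isCompact_iff_compactSpace.1 hKc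
  have : ConnectedSpace K := isConnected_iff_connectedSpace.1 hKconn
  refine isChainable_of_small_fibers fun ε hε => ?_
  obtain ⟨n, hn⟩ := exists_forall_ge_dist_lt f e hε
  set π : X → T (φ n) := fun x => (e x : ∀ n, T n) (φ n)
  have hπ : Continuous π :=
    (continuous_apply (φ n)).comp (continuous_subtype_val.comp e.continuous)
  obtain ⟨F, hF, hinj⟩ := (hT (φ n)).exists_continuous_injOn
    (hKconn.isPreconnected.image π hπ.continuousOn) (by
      rintro _ ⟨x, hx, rfl⟩ hbr
      have hmem : x ∈ U ∩ ⋃ i, branchFibres (fun x : X => (e x : ∀ n, T n) (φ i)) :=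
        ⟨hKU hx, mem_iUnion.2 ⟨n, mem_iUnion₂.2 ⟨π x, hbr, rfl⟩⟩⟩
      rw [hUd] at hmem
      exact hmem)
  refine ⟨fun x => F (π x), hF.comp (hπ.comp continuous_subtype_val), fun x y hxy => ?_⟩
  exact hn (φ n) (hφ.id_le n) x y
    (hinj (mem_image_of_mem π x.2) (mem_image_of_mem π y.2) hxy)


theorem mainTheorem1 {X : Type*} [MetricSpace X] [CompactSpace X] [ConnectedSpace X] [Nontrivial X]
    (hX : IsTreeLike X)
    {T : ℕ → Type*} [∀ n, TopologicalSpace (T n)] (hT : ∀ n, IsTopologicalTree (T n))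
    (f : ∀ ⦃n m : ℕ⦄, n ≤ m → T m → T n) [InverseSystem f]
    (hf_cont : ∀ (n m : ℕ) (h : n ≤ m), Continuous (f h))
    (hf_surj : ∀ (n m : ℕ) (h : n ≤ m), Function.Surjective (f h))
    (e : X ≃ₜ inverseLimit f) :
    (¬ Dense (⋃ n, branchFibres (fun x : X => (e x : ∀ n, T n) n)) →
      HasNondegenerateChainableSubcontinuum X) ∧
    (∀ φ : ℕ → ℕ, StrictMono φ →
      ¬ Dense (⋃ i, branchFibres (fun x : X => (e x : ∀ n, T n) (φ i))) →
      HasNondegenerateChainableSubcontinuum X) :=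
  ⟨fun h => hasNondegenerateChainableSubcontinuum_of_not_dense hT f e strictMono_id h,
    fun _ hφ h => hasNondegenerateChainableSubcontinuum_of_not_dense hT f e hφ h⟩
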